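/- **Theorem 1.3 (Existence Theorem of $\mathbf U$).** Let $\mathbb K$ be $\mathbb R$ or $\mathbb C$. A topological $\mathbb K$-vector space is *weakly complete* if it is isomorphic, as a topological vector space, to a power $\mathbb K^J$ with the product topology. Let $\mathcal{WA}$ be the category of weakly complete unital $\mathbb K$-algebras, that is, associative unital $\mathbb K$-algebras with a weakly complete vector space topology for which multiplication is (jointly) continuous; its morphisms are the continuous homomorphisms of unital algebras. A topological Lie algebra $\mathfrak g$ over $\mathbb K$ is *profinite-dimensional* if the canonical morphism $\mathfrak g\to\lim_{I}\mathfrak g/I$ is an isomorphism of topological Lie algebras, where $I$ ranges over the closed ideals of $\mathfrak g$ with $\dim\mathfrak g/I<\infty$; let $\mathcal{WL}$ be the category of profinite-dimensional $\mathbb K$-Lie algebras and continuous Lie algebra homomorphisms. For $A$ in $\mathcal{WA}$ let $\mathrm{Li}(A)$ be the topological vector space $A$ with the bracket $[x,y]=xy-yx$; it is profinite-dimensional, and $A\mapsto \mathrm{Li}(A)$ (with $f\mapsto f$ on morphisms) is a functor $\mathcal{WA}\to\mathcal{WL}$. The functor $\mathrm{Li}\colon\mathcal{WA}\to\mathcal{WL}$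 has a left adjoint $\mathbf U\colon\mathcal{WL}\to\mathcal{WA}$. In particular, with $\lambda_{\mathfrak g}\colon\mathfrak g\to\mathrm{Li}(\mathbf U(\mathfrak g))$ denoting the unit of the adjunction, for every $\mathfrak g$ in $\mathcal{WL}$, every $A$ in $\mathcal{WA}$ and every $\mathcal{WL}$-morphism $f\colon\mathfrak g\to\mathrm{Li}(A)$ there is a unique $\mathcal{WA}$-morphism $f'\colon\mathbf U(\mathfrak g)\to A$ with $f=\mathrm{Li}(f')\circ\lambda_{\mathfrak g}$. The algebra $\mathbf U(\mathfrak g)$ is called the weakly complete universal enveloping algebra of $\mathfrak g$. -/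

import Mathlib

open CategoryTheory Topology

universe u

/-! ### Weakly complete vector spaces and algebras -/

/-- A topological vector space over `𝕜` is weakly complete if it is isomorphic, as a topological
vector space, to a power `𝕜 ^ J` with the product topology. (As `J` embeds into `𝕜 ^ J`, taking
`J` in the universe of `E` is no restriction.) -/
def IsWeaklyComplete (𝕜 : Type) [RCLike 𝕜] (E : Type u) [AddCommGroup E] [Module 𝕜 E]
    [TopologicalSpace E] : Prop :=
  ∃ J : Type u, Nonempty (E ≃L[𝕜] (J → 𝕜))

/-- A weakly complete unital algebra over `𝕜`: an associative unital `𝕜`-algebra with a topology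
for which the ring operations are (jointly) continuous and the underlying topological vector space
is weakly complete. -/
structure WeaklyCompleteAlg (𝕜 : Type) [RCLike 𝕜] where
  /-- the underlying set -/
  carrier : Type u
  [ring : Ring carrier]
  [algebra : Algebra 𝕜 carrier]
  [topology : TopologicalSpace carrier]
  [topologicalRing : IsTopologicalRing carrier]
  weaklyComplete : IsWeaklyComplete 𝕜 carrier

attribute [instance] WeaklyCompleteAlg.ring WeaklyCompleteAlg.algebra
  WeaklyCompleteAlg.topology WeaklyCompleteAlg.topologicalRing

/-- The category of weakly complete unital algebras; the morphisms are the continuous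
homomorphisms of unital algebras. -/
instance WeaklyCompleteAlg.category (𝕜 : Type) [RCLike 𝕜] :
    Category (WeaklyCompleteAlg.{u} 𝕜) where
  Hom A B := A.carrier →A[𝕜] B.carrier
  id A := ContinuousAlgHom.id 𝕜 A.carrier
  comp f g := ContinuousAlgHom.comp g f

/-! ### Profinite-dimensional Lie algebras -/

/-- Topological Lie algebras: all operations, including the bracket, are (jointly) continuous. -/
class IsTopologicalLieAlgebra (𝕜 : Type) [RCLike 𝕜] (L : Type u) [LieRing L] [LieAlgebra 𝕜 L]
    [TopologicalSpace L] : Prop extends IsTopologicalAddGroup L, ContinuousSMul 𝕜 L where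
  continuous_lie : Continuous fun p : L × L => ⁅p.1, p.2⁆

section Limit

variable (𝕜 : Type) [RCLike 𝕜] (L : Type u) [LieRing L] [LieAlgebra 𝕜 L] [TopologicalSpace L]

/-- The closed ideals `I` of `L` with `dim (L ⧸ I) < ∞`. -/
def CofiniteIdeal : Type u :=
  {I : LieIdeal 𝕜 L // IsClosed (I : Set L) ∧ FiniteDimensional 𝕜 (L ⧸ I.toSubmodule)}

/-- The projective limit of the quotients `L ⧸ I` over the closed ideals `I` of finite codimension,
with respect to the quotient maps `L ⧸ J → L ⧸ I` for `J ⊆ I`: the set of compatible families in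
the product. It carries the subspace topology of the product of the quotient topologies; its Lie
algebra operations are the componentwise ones. -/
def LimitOfQuotients : Type u :=
  {x : (I : CofiniteIdeal 𝕜 L) → L ⧸ I.1.toSubmodule //
    ∀ (I J : CofiniteIdeal 𝕜 L) (h : J.1.toSubmodule ≤ I.1.toSubmodule),
      Submodule.factor h (x J) = x I}

instance : TopologicalSpace (LimitOfQuotients 𝕜 L) :=
  inferInstanceAs (TopologicalSpace {x : (I : CofiniteIdeal 𝕜 L) → L ⧸ I.1.toSubmodule //
    ∀ (I J : CofiniteIdeal 𝕜 L) (h : J.1.toSubmodule ≤ I.1.toSubmodule),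
      Submodule.factor h (x J) = x I})

/-- The canonical map `L → lim L ⧸ I`, `x ↦ (x + I)`. It is a homomorphism for the componentwise
Lie algebra operations. -/
def toLimitOfQuotients (x : L) : LimitOfQuotients 𝕜 L :=
  ⟨fun _ => Submodule.Quotient.mk x, fun _ _ _ => rfl⟩

/-- `L` is the projective limit of its quotients by closed ideals of finite codimension: the
canonical homomorphism `L → lim L ⧸ I` is an isomorphism of topological Lie algebras. -/
def IsProfiniteDimensional : Prop :=
  IsHomeomorph (toLimitOfQuotients 𝕜 L)

end Limit

/-- A profinite-dimensional Lie algebra over `𝕜`. -/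
structure ProfiniteDimLieAlg (𝕜 : Type) [RCLike 𝕜] where
  /-- the underlying set -/
  carrier : Type u
  [lieRing : LieRing carrier]
  [lieAlgebra : LieAlgebra 𝕜 carrier]
  [topology : TopologicalSpace carrier]
  [topologicalLieAlgebra : IsTopologicalLieAlgebra 𝕜 carrier]
  profiniteDimensional : IsProfiniteDimensional 𝕜 carrier

attribute [instance] ProfiniteDimLieAlg.lieRing ProfiniteDimLieAlg.lieAlgebra
  ProfiniteDimLieAlg.topology ProfiniteDimLieAlg.topologicalLieAlgebra

/-- Continuous homomorphisms of Lie algebras. -/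
@[ext]
structure ContinuousLieHom (𝕜 : Type) [RCLike 𝕜] (L M : Type u) [LieRing L] [LieAlgebra 𝕜 L]
    [TopologicalSpace L] [LieRing M] [LieAlgebra 𝕜 M] [TopologicalSpace M] where
  /-- the underlying Lie algebra homomorphism -/
  toLieHom : L →ₗ⁅𝕜⁆ M
  continuous_toLieHom : Continuous toLieHom

/-- The category of profinite-dimensional Lie algebras; the morphisms are the continuous
homomorphisms of Lie algebras. -/
instance ProfiniteDimLieAlg.category (𝕜 : Type) [RCLike 𝕜] :
    Category (ProfiniteDimLieAlg.{u} 𝕜) where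
  Hom L M := ContinuousLieHom 𝕜 L.carrier M.carrier
  id L := ⟨LieHom.id, continuous_id⟩
  comp f g := ⟨g.toLieHom.comp f.toLieHom, g.continuous_toLieHom.comp f.continuous_toLieHom⟩

/-! ### The underlying Lie algebra of a weakly complete unital algebra -/

section Underlying

variable {𝕜 : Type} [RCLike 𝕜] {A : Type u} [Ring A] [Algebra 𝕜 A]

theorem finiteDimensional_quotient_of_ker_le {N : Type*} [AddCommGroup N] [Module 𝕜 N]
    [FiniteDimensional 𝕜 N] (g : A →ₗ[𝕜] N) (I : Submodule 𝕜 A) (h : LinearMap.ker g ≤ I) :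
    FiniteDimensional 𝕜 (A ⧸ I) := by
  have : FiniteDimensional 𝕜 (A ⧸ LinearMap.ker g) :=
    Module.Finite.equiv g.quotKerEquivRange.symm
  refine Module.Finite.of_surjective (Submodule.factor h) ?_
  intro y
  obtain ⟨x, rfl⟩ := Submodule.Quotient.mk_surjective _ y
  exact ⟨Submodule.Quotient.mk x, rfl⟩

/-- The largest two-sided ideal on which the functional `f` vanishes. -/
def idealOfFunctional (f : A →ₗ[𝕜] 𝕜) : Submodule 𝕜 A where
  carrier := {x | ∀ a b, f (a * x * b) = 0}
  add_mem' hx hy a b := by simp [mul_add, add_mul, hx a b, hy a b]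
  zero_mem' a b := by simp
  smul_mem' c x hx a b := by simp [hx a b]

theorem finiteDimensional_idealOfFunctional [TopologicalSpace A] [IsTopologicalRing A]
    {J : Type u} (e : A ≃L[𝕜] (J → 𝕜)) (f : A →L[𝕜] 𝕜) :
    FiniteDimensional 𝕜 (A ⧸ idealOfFunctional (f : A →ₗ[𝕜] 𝕜)) := by
  have hc : Continuous fun p : A × A => f (p.1 * p.2) := by fun_prop
  have hn : {p : A × A | ‖f (p.1 * p.2)‖ < 1} ∈ 𝓝 ((0 : A), (0 : A)) := by
    refine (isOpen_lt (by fun_prop) continuous_const).mem_nhds ?_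
    simp
  rw [nhds_prod_eq, Filter.mem_prod_same_iff] at hn
  obtain ⟨U, hU, hUU⟩ := hn
  have hU' : e.symm ⁻¹' U ∈ 𝓝 (0 : J → 𝕜) :=
    e.symm.continuous.continuousAt.preimage_mem_nhds (by simpa using hU)
  rw [nhds_pi, Filter.mem_pi] at hU'
  obtain ⟨F, hF, t, ht, hsub⟩ := hU'
  have := hF.to_subtype
  have := Fintype.ofFinite F
  let g : A →ₗ[𝕜] (F → 𝕜) := LinearMap.pi fun j =>
    (LinearMap.proj (j : J) : (J → 𝕜) →ₗ[𝕜] 𝕜) ∘ₗ (e : A →ₗ[𝕜] (J → 𝕜))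
  have hgU : ∀ x ∈ LinearMap.ker g, x ∈ U := by
    intro x hx
    have : e x ∈ F.pi t := by
      intro j hj
      have h0 : e x j = 0 := congrFun (LinearMap.mem_ker.1 hx) ⟨j, hj⟩
      rw [h0]
      exact mem_of_mem_nhds (ht j)
    simpa using hsub this
  have hgf : ∀ x ∈ LinearMap.ker g, ∀ y ∈ U, f (x * y) = 0 := by
    intro x hx y hy
    by_contra hne
    have h1 := hUU (Set.mk_mem_prod
      (hgU _ ((LinearMap.ker g).smul_mem (f (x * y))⁻¹ hx)) hy)
    simp [hne] at h1
  have hgf' : ∀ x ∈ LinearMap.ker g, ∀ y, f (x * y) = 0 := by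
    intro x hx y
    have hcs : ContinuousSMul 𝕜 A := by
      refine ⟨?_⟩
      have : (fun p : 𝕜 × A => p.1 • p.2) = fun p => e.symm (p.1 • e p.2) := by
        ext p; simp
      rw [this]; fun_prop
    obtain ⟨c, hc0, hcU⟩ : ∃ c : 𝕜, c ≠ 0 ∧ c • y ∈ U := by
      have h2 : ∀ᶠ c : 𝕜 in 𝓝 0, c • y ∈ U :=
        (by fun_prop : Continuous fun c : 𝕜 => c • y).continuousAt.eventually
          (by simpa using hU)
      have h3 : ∀ᶠ c : 𝕜 in 𝓝[≠] 0, c ≠ 0 ∧ c • y ∈ U :=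
        Filter.Eventually.and (eventually_mem_nhdsWithin) (h2.filter_mono nhdsWithin_le_nhds)
      exact h3.exists
    have h4 := hgf x hx _ hcU
    simpa [hc0] using h4
  let R : Submodule 𝕜 A :=
    { carrier := {x | ∀ y, f (x * y) = 0}
      add_mem' := fun hx hy a => by simp [add_mul, hx a, hy a]
      zero_mem' := fun a => by simp
      smul_mem' := fun c x hx a => by simp [hx a] }
  have hR : FiniteDimensional 𝕜 (A ⧸ R) := finiteDimensional_quotient_of_ker_le g R hgf'
  let Ψ : (A ⧸ R) →ₗ[𝕜] A →ₗ[𝕜] (A ⧸ R) := R.liftQ ((LinearMap.mul 𝕜 A).compr₂ R.mkQ) (by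
    intro r hr
    rw [LinearMap.mem_ker]
    ext x
    refine (Submodule.Quotient.mk_eq_zero R).2 fun y => ?_
    have := hr (x * y)
    rwa [← mul_assoc] at this)
  refine finiteDimensional_quotient_of_ker_le Ψ.flip _ ?_
  intro x hx a b
  have h5 : Ψ.flip x (Submodule.Quotient.mk a) = 0 := by rw [LinearMap.mem_ker.1 hx]; rfl
  exact (Submodule.Quotient.mk_eq_zero R).1 h5 b

attribute [local instance 100] LieRing.ofAssociativeRing

theorem isTopologicalLieAlgebra_of_isWeaklyComplete [TopologicalSpace A] [IsTopologicalRing A]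
    (hA : IsWeaklyComplete 𝕜 A) : IsTopologicalLieAlgebra 𝕜 A := by
  obtain ⟨J, ⟨e⟩⟩ := hA
  have hcs : ContinuousSMul 𝕜 A := by
    refine ⟨?_⟩
    have : (fun p : 𝕜 × A => p.1 • p.2) = fun p => e.symm (p.1 • e p.2) := by
      ext p; simp
    rw [this]; fun_prop
  refine { continuous_lie := ?_ }
  simp only [LieRing.of_associative_ring_bracket]
  fun_prop

/-- The Lie algebra underlying a weakly complete unital algebra is profinite-dimensional. -/
theorem isProfiniteDimensional_of_isWeaklyComplete [TopologicalSpace A] [IsTopologicalRing A]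
    (hA : IsWeaklyComplete 𝕜 A) : IsProfiniteDimensional 𝕜 A := by
  obtain ⟨J, ⟨e⟩⟩ := hA
  let f (j : J) : A →L[𝕜] 𝕜 := (ContinuousLinearMap.proj j).comp (e : A →L[𝕜] (J → 𝕜))
  let K (j : J) : CofiniteIdeal 𝕜 A :=
    ⟨{ idealOfFunctional (f j : A →ₗ[𝕜] 𝕜) with
        lie_mem := by
          intro y x hx a b
          have h1 := hx (a * y) b
          have h2 := hx a (y * b)
          rw [LieRing.of_associative_ring_bracket, mul_sub, sub_mul, map_sub, ← mul_assoc,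
            h1, ← mul_assoc, mul_assoc (a * x), h2, sub_zero] },
      by
        have : {x : A | ∀ a b, f j (a * x * b) = 0} = ⋂ a, ⋂ b, {x | f j (a * x * b) = 0} := by
          ext; simp
        change IsClosed {x : A | ∀ a b, f j (a * x * b) = 0}
        rw [this]
        exact isClosed_iInter fun a => isClosed_iInter fun b =>
          isClosed_eq (by fun_prop) continuous_const,
      finiteDimensional_idealOfFunctional e (f j)⟩
  have hK (j : J) : (K j).1.toSubmodule ≤ LinearMap.ker (f j : A →ₗ[𝕜] 𝕜) := by
    intro x hx
    have h : f j (1 * x * 1) = 0 := hx 1 1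
    simpa using h
  let fb (j : J) : (A ⧸ (K j).1.toSubmodule) →ₗ[𝕜] 𝕜 :=
    (K j).1.toSubmodule.liftQ (f j : A →ₗ[𝕜] 𝕜) (hK j)
  have hfb (j : J) : Continuous (fb j) :=
    continuous_quot_lift _ (f j).continuous
  have hdir (I : CofiniteIdeal 𝕜 A) (F : Finset J) : ∃ M : CofiniteIdeal 𝕜 A,
      M.1.toSubmodule ≤ I.1.toSubmodule ∧ ∀ j ∈ F, M.1.toSubmodule ≤ (K j).1.toSubmodule := by
    classical
    induction F using Finset.induction_on with
    | empty => exact ⟨I, le_rfl, by simp⟩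
    | insert i F hi ih =>
      obtain ⟨M, hM, hMF⟩ := ih
      have := M.2.2
      have := (K i).2.2
      refine ⟨⟨M.1 ⊓ (K i).1, ?_, ?_⟩, ?_, ?_⟩
      · exact M.2.1.inter (K i).2.1
      · refine finiteDimensional_quotient_of_ker_le
          (M.1.toSubmodule.mkQ.prod (K i).1.toSubmodule.mkQ) _ ?_
        rw [LinearMap.ker_prod, Submodule.ker_mkQ, Submodule.ker_mkQ]
        exact fun x hx => hx
      · exact fun x hx => hM hx.1
      · intro j hj
        rcases Finset.mem_insert.1 hj with rfl | hj
        · exact fun x hx => hx.2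
        · exact fun x hx => hMF j hj hx.1
  refine isHomeomorph_iff_exists_inverse.2 ⟨?_, fun x => e.symm fun j => fb j (x.1 (K j)),
    ?_, ?_, ?_⟩
  · exact Continuous.subtype_mk (continuous_pi fun I => continuous_quot_mk) _
  · intro x
    exact e.symm_apply_apply x
  · intro x
    refine Subtype.ext (funext fun I => ?_)
    obtain ⟨w₀, hw₀⟩ := Submodule.Quotient.mk_surjective _ (x.1 I)
    set z : A := e.symm fun j => fb j (x.1 (K j)) with hz
    change Submodule.Quotient.mk z = x.1 I
    rw [← hw₀, Submodule.Quotient.eq]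
    suffices h : z - w₀ ∈ closure (I.1 : Set A) by rwa [I.2.1.closure_eq] at h
    rw [mem_closure_iff_nhds]
    intro U hU
    have hU' : (fun p : J → 𝕜 => e.symm p - w₀) ⁻¹' U ∈ 𝓝 (e z) := by
      refine ContinuousAt.preimage_mem_nhds (by fun_prop) ?_
      simpa using hU
    rw [nhds_pi, Filter.mem_pi] at hU'
    obtain ⟨F, hF, t, ht, hsub⟩ := hU'
    obtain ⟨M, hMI, hMF⟩ := hdir I hF.toFinset
    obtain ⟨w, hw⟩ := Submodule.Quotient.mk_surjective _ (x.1 M)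
    refine ⟨w - w₀, ?_, ?_⟩
    · have hmem : e w ∈ F.pi t := by
        intro j hj
        have h1 : x.1 (K j) = Submodule.Quotient.mk w := by
          rw [← x.2 (K j) M (hMF j (by simpa using hj)), ← hw]
          rfl
        have h2 : e z j = e w j := by
          rw [hz, e.apply_symm_apply]
          rw [h1]
          rfl
        rw [← h2]
        exact mem_of_mem_nhds (ht j)
      simpa using hsub hmem
    · have h3 : Submodule.Quotient.mk w = x.1 I := by
        rw [← x.2 I M hMI, ← hw]
        rfl
      rw [← hw₀, Submodule.Quotient.eq] at h3
      exact h3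
  · refine e.symm.continuous.comp (continuous_pi fun j => (hfb j).comp ?_)
    exact (continuous_apply (K j)).comp continuous_subtype_val

/-- The underlying Lie algebra `Li A` of a weakly complete unital algebra `A`: the same
topological vector space with the bracket `⁅x, y⁆ = x * y - y * x`. -/
def WeaklyCompleteAlg.li {𝕜 : Type} [RCLike 𝕜] (A : WeaklyCompleteAlg.{u} 𝕜) :
    ProfiniteDimLieAlg.{u} 𝕜 where
  carrier := A.carrier
  lieRing := LieRing.ofAssociativeRing
  lieAlgebra := LieAlgebra.ofAssociativeAlgebra
  topology := A.topology
  topologicalLieAlgebra := isTopologicalLieAlgebra_of_isWeaklyComplete A.weaklyComplete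
  profiniteDimensional := isProfiniteDimensional_of_isWeaklyComplete A.weaklyComplete

/-- The underlying Lie algebra functor `A ↦ Li A`. -/
def underlyingLieAlgebra (𝕜 : Type) [RCLike 𝕜] :
    WeaklyCompleteAlg.{u} 𝕜 ⥤ ProfiniteDimLieAlg.{u} 𝕜 where
  obj A := A.li
  map {A B} f :=
    let φ : A.carrier →A[𝕜] B.carrier := f
    (⟨AlgHom.toLieHom φ.toAlgHom, φ.cont⟩ : ContinuousLieHom 𝕜 A.carrier B.carrier)

end Underlying

/-!
Every weakly complete algebra `A` embeds, as a topological algebra, in a product of matrix algebras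
over `𝕜`: each coordinate functional of `A` factors through left multiplication on a
finite-dimensional quotient algebra (`exists_matrix_representation`). The factorizations give
the embedding a continuous linear left inverse, so its range is closed
(`exists_embedding_pi_matrix`).

A continuous Lie algebra homomorphism `f : 𝔤 → Li A` is therefore determined by a family of
continuous matrix representations of `𝔤`. These form a set, with no bound on the degree needed, and
`U 𝔤` is the closed subalgebra generated by the diagonal image of `𝔤` in the product of the matrix
algebras over all continuous matrix representations of `𝔤`. Projecting onto the representations that
come from `f` maps `U 𝔤` into the closed image of `A`; this is the required extension of `f`
(`exists_lift_envelopingSubalgebra`). It is unique because `𝔤` generates `U 𝔤` topologically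
(`envelopingSubalgebra_hom_ext`). That `U 𝔤` is again weakly complete follows from the fact that
closed subspaces of powers of `𝕜` are powers of `𝕜` (`IsWeaklyComplete.of_isClosed`).

Hence every comma category `𝔤 ↓ Li` has an initial object, which is to say that `Li` has a left
adjoint. The universal property of the unit then holds for any choice of the adjunction.
-/

/-! ### Weakly complete vector spaces -/

section WeaklyComplete

variable {𝕜 : Type} [RCLike 𝕜]

theorem IsWeaklyComplete.t2Space {E : Type u} [AddCommGroup E] [Module 𝕜 E] [TopologicalSpace E]
    (hE : IsWeaklyComplete 𝕜 E) : T2Space E := by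
  obtain ⟨J, ⟨e⟩⟩ := hE
  exact e.toHomeomorph.symm.t2Space

theorem LinearIndependent.pi_surjective {K V ι : Type*} [Field K] [AddCommGroup V] [Module K V]
    [Finite ι] {l : ι → V →ₗ[K] K} (hl : LinearIndependent K l) :
    Function.Surjective (LinearMap.pi l) := by
  classical
  have := Fintype.ofFinite ι
  by_contra hs
  rw [← LinearMap.range_eq_top] at hs
  obtain ⟨φ, hφ, hle⟩ := Submodule.exists_le_ker_of_lt_top _ (lt_top_iff_ne_top.2 hs)
  have h0 : ∑ i, φ (Pi.single i 1) • l i = 0 := by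
    ext v
    have h1 : φ (LinearMap.pi l v) = 0 := hle ⟨v, rfl⟩
    rw [← LinearMap.sum_single_apply _ (LinearMap.pi l v), map_sum] at h1
    rw [LinearMap.sum_apply, LinearMap.zero_apply, ← h1]
    refine Finset.sum_congr rfl fun i _ => ?_
    have h2 : Pi.single i (LinearMap.pi l v i) = l i v • (Pi.single i 1 : ι → K) := by
      ext j
      simp [Pi.single_apply]
    rw [h2, map_smul]
    simp [mul_comm]
  refine hφ (LinearMap.pi_ext' fun i => LinearMap.ext_ring ?_)
  simpa using Fintype.linearIndependent_iff.1 hl _ h0 i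

/-- A closed subspace `W` of a weakly complete space is weakly complete. A maximal linearly
independent subfamily of the restrictions to `W` of the coordinate functionals maps `W`
isomorphically onto a power of `𝕜`: the remaining coordinates are finite linear combinations of
these, so every vector of the power can be approximated by, and hence comes from, a vector
of `W`. -/
theorem IsWeaklyComplete.of_isClosed {E : Type u} [AddCommGroup E] [Module 𝕜 E]
    [TopologicalSpace E] (hE : IsWeaklyComplete 𝕜 E) (W : Submodule 𝕜 E)
    (hW : IsClosed (W : Set E)) : IsWeaklyComplete 𝕜 W := by
  obtain ⟨J, ⟨e⟩⟩ := hE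
  let l (j : J) : W →ₗ[𝕜] 𝕜 := LinearMap.proj j ∘ₗ (e : E →ₗ[𝕜] (J → 𝕜)) ∘ₗ W.subtype
  have hl (j : J) (w : W) : l j w = e w j := rfl
  obtain ⟨Y, a, -, hspan, hli⟩ := exists_linearIndependent' 𝕜 l
  have hmem (j : J) : l j ∈ Submodule.span 𝕜 (Set.range (l ∘ a)) :=
    hspan ▸ Submodule.subset_span ⟨j, rfl⟩
  choose c hc using fun j => (Finsupp.mem_span_range_iff_exists_finsupp).1 (hmem j)
  have hca (y : Y) : c (a y) = Finsupp.single y 1 := by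
    apply hli
    rw [Finsupp.linearCombination_single, one_smul, Finsupp.linearCombination_apply]
    exact hc (a y)
  have hcl (j : J) (w : W) : ((c j).sum fun y r => r * l (a y) w) = l j w := by
    rw [← hc j]
    simp [Finsupp.sum, LinearMap.sum_apply]
  let s (t : Y → 𝕜) : J → 𝕜 := fun j => (c j).sum fun y r => r * t y
  have hs : Continuous s := continuous_pi fun j =>
    continuous_finsetSum _ fun y _ => continuous_const.mul (continuous_apply y)
  have hsW (t : Y → 𝕜) : e.symm (s t) ∈ W := by
    have hcl' : e.symm (s t) ∈ closure (W : Set E) := by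
      rw [mem_closure_iff_nhds]
      intro U hU
      have hU' : e.symm ⁻¹' U ∈ 𝓝 (s t) := e.symm.continuous.continuousAt.preimage_mem_nhds hU
      rw [nhds_pi, Filter.mem_pi] at hU'
      obtain ⟨F, hF, V, hV, hsub⟩ := hU'
      classical
      let G : Finset Y := hF.toFinset.biUnion fun j => (c j).support
      have hG : LinearIndependent 𝕜 fun y : G => l (a y) :=
        hli.comp _ Subtype.val_injective
      obtain ⟨w, hw⟩ := hG.pi_surjective fun y => t y
      refine ⟨w, ?_, w.2⟩
      have : e w ∈ F.pi V := by
        intro j hj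
        have h1 : e w j = s t j := by
          rw [← hl, ← hcl]
          refine Finset.sum_congr rfl fun y hy => ?_
          have h2 : l (a y) w = t y := congrFun hw
            ⟨y, Finset.mem_biUnion.2 ⟨j, by simpa using hj, hy⟩⟩
          simp only [h2]
        rw [h1]
        exact mem_of_mem_nhds (hV j)
      simpa using hsub this
    rwa [hW.closure_eq] at hcl'
  refine ⟨Y, ⟨{ LinearMap.pi fun y => l (a y) with
    invFun := fun t => ⟨e.symm (s t), hsW t⟩
    left_inv := ?_
    right_inv := ?_
    continuous_toFun := ?_
    continuous_invFun := ?_ }⟩⟩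
  · intro w
    refine Subtype.ext ?_
    change e.symm (s fun y => l (a y) w) = w
    rw [e.symm_apply_eq]
    exact funext fun j => hcl j w
  · intro t
    funext y
    change e (e.symm (s t)) (a y) = t y
    simp [s, hca]
  · exact continuous_pi fun y =>
      (continuous_apply (a y)).comp (e.continuous.comp continuous_subtype_val)
  · exact (e.symm.continuous.comp hs).subtype_mk _

/-- A product of matrix algebras is weakly complete: the entries are its coordinates. -/
theorem isWeaklyComplete_pi_matrix {ι : Type u} (n : ι → ℕ) :
    IsWeaklyComplete 𝕜 ((i : ι) → Matrix (Fin (n i)) (Fin (n i)) 𝕜) :=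
  ⟨Σ i, Fin (n i) × Fin (n i), ⟨{
    toFun := fun x p => x p.1 p.2.1 p.2.2
    invFun := fun y i => Matrix.of fun a b => y ⟨i, a, b⟩
    map_add' := fun _ _ => rfl
    map_smul' := fun _ _ => rfl
    left_inv := fun _ => rfl
    right_inv := fun _ => rfl
    continuous_toFun := continuous_pi fun p =>
      ((continuous_apply p.1).matrix_elem p.2.1 p.2.2)
    continuous_invFun := continuous_pi fun _ => continuous_matrix fun _ _ =>
      continuous_apply _ }⟩⟩

end WeaklyComplete

/-! ### Finite-dimensional representations of weakly complete algebras -/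

section Representation

variable {𝕜 : Type} [RCLike 𝕜] {A : Type u} [Ring A] [Algebra 𝕜 A] [TopologicalSpace A]
  [IsTopologicalRing A]

/-- Every continuous functional `f` on a weakly complete algebra factors through a continuous
matrix representation, namely left multiplication on the quotient by the largest two-sided ideal
contained in the kernel of `f`. -/
theorem exists_matrix_representation (hA : IsWeaklyComplete 𝕜 A) (f : A →L[𝕜] 𝕜) :
    ∃ (n : ℕ) (ρ : A →A[𝕜] Matrix (Fin n) (Fin n) 𝕜) (g : Matrix (Fin n) (Fin n) 𝕜 →ₗ[𝕜] 𝕜),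
      ∀ x, g (ρ x) = f x := by
  have := isTopologicalLieAlgebra_of_isWeaklyComplete hA
  have hcs : ContinuousSMul 𝕜 A := this.toContinuousSMul
  obtain ⟨J, ⟨e⟩⟩ := hA
  let I : Submodule 𝕜 A := idealOfFunctional (f : A →ₗ[𝕜] 𝕜)
  have hfin : FiniteDimensional 𝕜 (A ⧸ I) := finiteDimensional_idealOfFunctional e f
  have hclosed : IsClosed (I : Set A) := by
    have : (I : Set A) = ⋂ a, ⋂ b, {x | f (a * x * b) = 0} := by
      ext; simp [I, idealOfFunctional]
    rw [this]
    exact isClosed_iInter fun a => isClosed_iInter fun b =>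
      isClosed_eq (by fun_prop) continuous_const
  let m : A →ₐ[𝕜] Module.End 𝕜 (A ⧸ I) := AlgHom.ofLinearMap
    { toFun := fun x => I.mapQ I (LinearMap.mulLeft 𝕜 x) (by
        intro y hy a b
        have := hy (a * x) b
        simpa [mul_assoc] using this)
      map_add' := fun x y => by
        ext z
        exact congrArg I.mkQ (add_mul x y z)
      map_smul' := fun c x => by
        ext z
        exact congrArg I.mkQ (smul_mul_assoc c x z) }
    (by ext z; simp)
    (fun x y => by
      ext z
      exact congrArg I.mkQ (mul_assoc x y z))
  have hm (x y : A) : m x (I.mkQ y) = I.mkQ (x * y) := rfl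
  let b := Module.finBasis 𝕜 (A ⧸ I)
  let ρ := (LinearMap.toMatrixAlgEquiv b).toAlgHom.comp m
  have hρ : Continuous ρ := by
    refine continuous_matrix fun i j => ?_
    obtain ⟨y, hy⟩ := I.mkQ_surjective (b j)
    have h1 (x : A) : ρ x i j = b.coord i (I.mkQ (x * y)) := by
      simp only [ρ, AlgHom.comp_apply]
      change LinearMap.toMatrixAlgEquiv b (m x) i j = _
      rw [LinearMap.toMatrixAlgEquiv_apply, ← hy, hm]
      rfl
    simp only [h1]
    -- The quotient is Hausdorff because `I` is closed, so its linear functionals are continuous.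
    have h2 : Continuous (b.coord i) := LinearMap.continuous_of_finiteDimensional _
    exact h2.comp (continuous_quot_mk.comp (by fun_prop : Continuous fun x => x * y))
  have hI : I ≤ LinearMap.ker (f : A →ₗ[𝕜] 𝕜) := fun x hx => by simpa using hx 1 1
  refine ⟨_, ⟨ρ, hρ⟩, I.liftQ (f : A →ₗ[𝕜] 𝕜) hI ∘ₗ LinearMap.applyₗ (I.mkQ 1) ∘ₗ
    (LinearMap.toMatrixAlgEquiv b).symm.toLinearMap, fun x => ?_⟩
  change I.liftQ (f : A →ₗ[𝕜] 𝕜) hI ((LinearMap.toMatrixAlgEquiv b).symm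
    (LinearMap.toMatrixAlgEquiv b (m x)) (I.mkQ 1)) = f x
  rw [AlgEquiv.symm_apply_apply, hm, mul_one]
  rfl

/-- A weakly complete algebra `A` is a topological retract, as a vector space, of a product of
matrix algebras in which it embeds as an algebra. -/
theorem exists_embedding_pi_matrix (hA : IsWeaklyComplete 𝕜 A) :
    ∃ (J : Type u) (n : J → ℕ) (ρ : A →A[𝕜] ((j : J) → Matrix (Fin (n j)) (Fin (n j)) 𝕜))
      (r : ((j : J) → Matrix (Fin (n j)) (Fin (n j)) 𝕜) →L[𝕜] A), ∀ x, r (ρ x) = x := by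
  have hA' := hA
  obtain ⟨J, ⟨e⟩⟩ := hA
  choose n ρ g h using fun j : J => exists_matrix_representation hA'
    ((ContinuousLinearMap.proj j).comp (e : A →L[𝕜] (J → 𝕜)))
  refine ⟨J, n, ⟨AlgHom.pi fun j => (ρ j).toAlgHom, continuous_pi fun j => (ρ j).cont⟩,
    (e.symm : (J → 𝕜) →L[𝕜] A).comp (ContinuousLinearMap.pi fun j =>
      (⟨g j, LinearMap.continuous_of_finiteDimensional _⟩ : _ →L[𝕜] 𝕜).comp
        (ContinuousLinearMap.proj j)), fun x => ?_⟩
  change e.symm (fun j => g j (ρ j x)) = x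
  rw [e.symm_apply_eq]
  exact funext fun j => h j x

end Representation

/-! ### The weakly complete universal enveloping algebra -/

section Enveloping

attribute [local instance 100] LieRing.ofAssociativeRing

variable (𝕜 : Type) [RCLike 𝕜] (L : Type u) [LieRing L] [LieAlgebra 𝕜 L] [TopologicalSpace L]

/-- The continuous matrix representations of a topological Lie algebra, each given by its degree
and a continuous Lie algebra homomorphism into the matrix algebra of that degree. -/
def ContinuousMatrixRep : Type u :=
  Σ n : ℕ, {ρ : L →ₗ⁅𝕜⁆ Matrix (Fin n) (Fin n) 𝕜 // Continuous ρ}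

/-- The product of the matrix algebras over all continuous matrix representations of `L`. -/
abbrev MatrixRepProduct : Type u :=
  (i : ContinuousMatrixRep 𝕜 L) → Matrix (Fin i.1) (Fin i.1) 𝕜

/-- The map collecting all continuous matrix representations of `L`. -/
def diagonalRep : L →ₗ[𝕜] MatrixRepProduct 𝕜 L :=
  LinearMap.pi fun i => (i.2.1 : L →ₗ[𝕜] Matrix (Fin i.1) (Fin i.1) 𝕜)

theorem continuous_diagonalRep : Continuous (diagonalRep 𝕜 L) :=
  continuous_pi fun i => i.2.2

theorem diagonalRep_lie (x y : L) : diagonalRep 𝕜 L ⁅x, y⁆ =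
    diagonalRep 𝕜 L x * diagonalRep 𝕜 L y - diagonalRep 𝕜 L y * diagonalRep 𝕜 L x :=
  funext fun i => i.2.1.map_lie x y

/-- The closed subalgebra generated by `L` in the product of the matrix algebras over all
continuous matrix representations of `L`. -/
def envelopingSubalgebra : Subalgebra 𝕜 (MatrixRepProduct 𝕜 L) :=
  (Algebra.adjoin 𝕜 (Set.range (diagonalRep 𝕜 L))).topologicalClosure

theorem diagonalRep_mem (x : L) : diagonalRep 𝕜 L x ∈ envelopingSubalgebra 𝕜 L :=
  Subalgebra.le_topologicalClosure _ (Algebra.subset_adjoin ⟨x, rfl⟩)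

theorem isClosed_envelopingSubalgebra :
    IsClosed (envelopingSubalgebra 𝕜 L : Set (MatrixRepProduct 𝕜 L)) :=
  Subalgebra.isClosed_topologicalClosure _

/-- The weakly complete universal enveloping algebra of `L`: the closed subalgebra generated by `L`
in the product of the matrix algebras over all continuous matrix representations of `L`. -/
def weaklyCompleteEnvelopingAlg : WeaklyCompleteAlg.{u} 𝕜 where
  carrier := envelopingSubalgebra 𝕜 L
  topologicalRing := (envelopingSubalgebra 𝕜 L).toSubring.instIsTopologicalRing
  weaklyComplete := (isWeaklyComplete_pi_matrix _).of_isClosed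
    (envelopingSubalgebra 𝕜 L).toSubmodule (isClosed_envelopingSubalgebra 𝕜 L)

variable {L}

/-- The canonical map of a Lie algebra into its weakly complete enveloping algebra. -/
def toEnveloping : ContinuousLieHom 𝕜 L (weaklyCompleteEnvelopingAlg 𝕜 L).li.carrier where
  toLieHom :=
    { toFun := fun x => (⟨diagonalRep 𝕜 L x, diagonalRep_mem 𝕜 L x⟩ : envelopingSubalgebra 𝕜 L)
      map_add' := fun x y => Subtype.ext ((diagonalRep 𝕜 L).map_add x y)
      map_smul' := fun c x => Subtype.ext ((diagonalRep 𝕜 L).map_smul c x)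
      map_lie' := fun {x y} => Subtype.ext (diagonalRep_lie 𝕜 L x y) }
  continuous_toLieHom := (continuous_diagonalRep 𝕜 L).subtype_mk _

variable {𝕜} {A : Type u} [Ring A] [Algebra 𝕜 A] [TopologicalSpace A]

/-- Existence in the universal property. For an embedding `ρ` of `A` into a product of matrix
algebras, each component of `ρ ∘ f` is one of the representations over which the product
containing the enveloping algebra is taken. The corresponding projection maps the enveloping
algebra into the range of `ρ`, which is closed because `ρ` has a continuous left inverse. -/
theorem exists_lift_envelopingSubalgebra [IsTopologicalRing A] (hA : IsWeaklyComplete 𝕜 A)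
    (f : L →ₗ⁅𝕜⁆ A) (hf : Continuous f) : ∃ φ : envelopingSubalgebra 𝕜 L →A[𝕜] A,
      ∀ x, φ ⟨diagonalRep 𝕜 L x, diagonalRep_mem 𝕜 L x⟩ = f x := by
  obtain ⟨J, n, ρ, r, hr⟩ := exists_embedding_pi_matrix hA
  let i (j : J) : ContinuousMatrixRep 𝕜 L :=
    ⟨n j, ((Pi.evalAlgHom 𝕜 _ j).comp ρ.toAlgHom).toLieHom.comp f,
      (continuous_apply j).comp (ρ.cont.comp hf)⟩
  let p : MatrixRepProduct 𝕜 L →ₐ[𝕜] ((j : J) → Matrix (Fin (n j)) (Fin (n j)) 𝕜) :=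
    AlgHom.pi fun j => Pi.evalAlgHom 𝕜 _ (i j)
  have hp : Continuous p := continuous_pi fun j => continuous_apply (i j)
  have hpf (x : L) : p (diagonalRep 𝕜 L x) = ρ (f x) := rfl
  have hmem : envelopingSubalgebra 𝕜 L ≤ ρ.toAlgHom.range.comap p := by
    refine Subalgebra.topologicalClosure_minimal (Algebra.adjoin_le ?_) ?_
    · rintro _ ⟨x, rfl⟩
      exact ⟨f x, (hpf x).symm⟩
    · have : ((ρ.toAlgHom.range.comap p : Subalgebra 𝕜 (MatrixRepProduct 𝕜 L)) : Set _) =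
          {y | ρ (r (p y)) = p y} := by
        ext y
        refine ⟨?_, fun h => ⟨_, h⟩⟩
        rintro ⟨a, ha : ρ a = p y⟩
        change ρ (r (p y)) = p y
        rw [← ha, hr]
      rw [this]
      exact isClosed_eq (ρ.cont.comp (r.continuous.comp hp)) hp
  have hrp (y : envelopingSubalgebra 𝕜 L) : ρ (r (p y)) = p y := by
    obtain ⟨a, ha⟩ := hmem y.2
    have ha' : ρ a = p y := ha
    rw [← ha', hr]
  have hinj : Function.Injective ρ := Function.LeftInverse.injective hr
  refine ⟨⟨AlgHom.ofLinearMap (r.toLinearMap ∘ₗ p.toLinearMap ∘ₗ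
    (envelopingSubalgebra 𝕜 L).val.toLinearMap : envelopingSubalgebra 𝕜 L →ₗ[𝕜] A) ?_ ?_,
    r.continuous.comp (hp.comp continuous_subtype_val)⟩, fun x => ?_⟩
  · change r (p 1) = 1
    rw [map_one, ← map_one ρ, hr]
  · intro y z
    change r (p (y * z)) = r (p y) * r (p z)
    apply hinj
    rw [map_mul ρ, hrp, hrp, map_mul, ← hrp y, ← hrp z, ← map_mul ρ, hr]
  · change r (p (diagonalRep 𝕜 L x)) = f x
    rw [hpf, hr]

/-- Uniqueness in the universal property: `L` generates its enveloping algebra topologically. -/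
theorem envelopingSubalgebra_hom_ext (hA : IsWeaklyComplete 𝕜 A)
    {φ ψ : envelopingSubalgebra 𝕜 L →A[𝕜] A}
    (h : ∀ x, φ ⟨diagonalRep 𝕜 L x, diagonalRep_mem 𝕜 L x⟩ =
      ψ ⟨diagonalRep 𝕜 L x, diagonalRep_mem 𝕜 L x⟩) : φ = ψ := by
  have := hA.t2Space
  let E : Subalgebra 𝕜 (envelopingSubalgebra 𝕜 L) := AlgHom.equalizer φ.toAlgHom ψ.toAlgHom
  have hle : Algebra.adjoin 𝕜 (Set.range (diagonalRep 𝕜 L)) ≤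
      E.map (envelopingSubalgebra 𝕜 L).val := by
    refine Algebra.adjoin_le ?_
    rintro _ ⟨x, rfl⟩
    exact ⟨_, h x, rfl⟩
  have hclosed : IsClosed (E.map (envelopingSubalgebra 𝕜 L).val : Set (MatrixRepProduct 𝕜 L)) :=
    (isClosed_envelopingSubalgebra 𝕜 L).isClosedEmbedding_subtypeVal.isClosedMap _
      (isClosed_eq φ.cont ψ.cont)
  refine ContinuousAlgHom.ext fun y => ?_
  obtain ⟨z, hz, hzy⟩ := Subalgebra.topologicalClosure_minimal hle hclosed y.2
  obtain rfl : z = y := Subtype.ext hzy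
  exact hz

end Enveloping

/-! ### The adjunction -/

section Adjunction

variable (𝕜 : Type) [RCLike 𝕜]

/-- The universal property of the enveloping algebra, in terms of the categories. -/
theorem existsUnique_lift_toEnveloping (𝔤 : ProfiniteDimLieAlg.{u} 𝕜)
    (A : WeaklyCompleteAlg.{u} 𝕜) (f : 𝔤 ⟶ (underlyingLieAlgebra.{u} 𝕜).obj A) :
    ∃! φ : weaklyCompleteEnvelopingAlg 𝕜 𝔤.carrier ⟶ A,
      (show 𝔤 ⟶ (underlyingLieAlgebra.{u} 𝕜).obj (weaklyCompleteEnvelopingAlg 𝕜 𝔤.carrier) from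
        toEnveloping 𝕜) ≫ (underlyingLieAlgebra.{u} 𝕜).map φ = f := by
  let f' : ContinuousLieHom 𝕜 𝔤.carrier A.li.carrier := f
  obtain ⟨φ, hφ⟩ := exists_lift_envelopingSubalgebra A.weaklyComplete f'.toLieHom
    f'.continuous_toLieHom
  refine ⟨φ, ContinuousLieHom.ext (LieHom.ext hφ), fun ψ hψ => ?_⟩
  refine envelopingSubalgebra_hom_ext A.weaklyComplete fun x => ?_
  rw [hφ]
  exact congrArg (fun g : ContinuousLieHom 𝕜 𝔤.carrier A.li.carrier => g.toLieHom x) hψ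

theorem isRightAdjoint_underlyingLieAlgebra : (underlyingLieAlgebra.{u} 𝕜).IsRightAdjoint := by
  have (𝔤 : ProfiniteDimLieAlg.{u} 𝕜) :
      Limits.HasInitial (StructuredArrow 𝔤 (underlyingLieAlgebra.{u} 𝕜)) := by
    refine Limits.IsInitial.hasInitial (X := StructuredArrow.mk
      (show 𝔤 ⟶ (underlyingLieAlgebra.{u} 𝕜).obj (weaklyCompleteEnvelopingAlg 𝕜 𝔤.carrier) from
        toEnveloping 𝕜)) (Limits.IsInitial.ofUniqueHom (fun Y => StructuredArrow.homMk
        (existsUnique_lift_toEnveloping 𝕜 𝔤 Y.right Y.hom).choose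
        (existsUnique_lift_toEnveloping 𝕜 𝔤 Y.right Y.hom).choose_spec.1) fun Y m => ?_)
    exact StructuredArrow.ext _ _ <|
      (existsUnique_lift_toEnveloping 𝕜 𝔤 Y.right Y.hom).choose_spec.2 _ (StructuredArrow.w m)
  exact isRightAdjointOfStructuredArrowInitials _

end Adjunction

/-- The underlying Lie algebra functor from weakly complete unital `𝕜`-algebras to
profinite-dimensional `𝕜`-Lie algebras has a left adjoint `U`. Its value at `𝔤`, with the unit
`𝔤 ⟶ Li (U 𝔤)` of the adjunction, is the weakly complete universal enveloping algebra of `𝔤`: each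
morphism `f : 𝔤 ⟶ Li A` factors through the unit by a unique morphism `U 𝔤 ⟶ A`. -/
theorem theorem1p3 (𝕜 : Type) [RCLike 𝕜] :
    ∃ (U : ProfiniteDimLieAlg.{u} 𝕜 ⥤ WeaklyCompleteAlg.{u} 𝕜)
      (adj : U ⊣ underlyingLieAlgebra.{u} 𝕜),
      ∀ (𝔤 : ProfiniteDimLieAlg.{u} 𝕜) (A : WeaklyCompleteAlg.{u} 𝕜)
        (f : 𝔤 ⟶ (underlyingLieAlgebra.{u} 𝕜).obj A),
        ∃! f' : U.obj 𝔤 ⟶ A, adj.unit.app 𝔤 ≫ (underlyingLieAlgebra.{u} 𝕜).map f' = f := by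
  have := isRightAdjoint_underlyingLieAlgebra.{u} 𝕜
  let adj := Adjunction.ofIsRightAdjoint (underlyingLieAlgebra.{u} 𝕜)
  refine ⟨_, adj, fun 𝔤 A f => ⟨(adj.homEquiv 𝔤 A).symm f, ?_, fun g hg => ?_⟩⟩
  · exact (adj.homEquiv_unit _ _ _).symm.trans ((adj.homEquiv 𝔤 A).apply_symm_apply f)
  · exact ((adj.homEquiv 𝔤 A).eq_symm_apply).2 ((adj.homEquiv_unit _ _ _).trans hg)
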